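/- Let $j:\mathbb{H}\to\mathbb{C}$ be the modular $j$-function on the upper half-plane, normalised as usual: $j=E_4^3/\Delta$, where $E_4(\tau)=1+240\sum_{n\ge1}\sigma_3(n)q^n$ and $\Delta(\tau)=q\prod_{n\ge1}(1-q^n)^{24}$ with $q=e^{2\pi\mathrm{i}\tau}$, so that $j=q^{-1}+744+\cdots$, $j(\mathrm{i})=1728$ and $j(e^{\pi\mathrm{i}/3})=0$. Then $$j(\sqrt3\,\mathrm{i})=16\cdot15^3,\qquad j(2\mathrm{i})=66^3,\qquad j(\sqrt2\,\mathrm{i})=20^3,\qquad j\!\left(\frac{1+3\sqrt3\,\mathrm{i}}{2}\right)=-3\cdot160^3,$$ $$j(3\mathrm{i})=\left(18+6\sqrt3\right)\left(82+54\sqrt3\right)^3,\qquad j\!\left(\frac{1+3\mathrm{i}}{2}\right)=\left(18-6\sqrt3\right)\left(82-54\sqrt3\right)^3.$$ -/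

import Mathlib

open Complex

open UpperHalfPlane hiding I

/-- The modular `j`-function `j : ℍ → ℂ`, `j(τ) = E₄(τ)³ / Δ(τ)`, where `E₄ = 1 + 240 q + ⋯` is the
normalised Eisenstein series of weight `4` and
`Δ(τ) = q ∏ (1 - qⁿ)²⁴ = (E₄(τ)³ - E₆(τ)²) / 1728` is the modular discriminant, which vanishes
nowhere on `ℍ`. In this normalisation `j = q⁻¹ + 744 + ⋯` with `q = exp (2πiτ)`, `j(i) = 1728`
and `j(exp (πi/3)) = 0`. -/
noncomputable def modularJ (τ : ℍ) : ℂ :=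
  (ModularForm.E₄ τ) ^ 3 / ModularForm.discriminant τ

/-!
# Six singular values of the `j`-function

Each of the six points is, up to a translation by `1`, of the form `p τ` with `p = 2` or `p = 3`,
where `τ` is a point fixed by an element of `SL(2, ℤ)` (`i`, `(1 + i) / 2`, `(1 + √3 i) / 2`) or
with `p τ = -1 / τ` (`√2 i / 2`, `√3 i / 3`). The values follow from explicit algebraic relations
describing the `p`-isogeny from `τ` to `p τ` in terms of the "isogeny root"
`e = p² E₂(pτ) - p E₂(τ)`:

* `p = 2`: `e³ - 3 E₄(τ) e - 2 E₆(τ) = 0` and `16 E₄(2τ) = -4 E₄(τ) + 5 e²`;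
* `p = 3`: `e⁴ - 24 E₄(τ) e² - 64 E₆(τ) e - 48 E₄(τ)² = 0` and
  `81 E₄(3τ) = -9 E₄(τ) + (5 / 2) e²`.

To prove them, complete `e` to the family of the `p + 1` isogeny roots attached to `pτ` and
`(τ + a) / p`, `a ∈ ℤ / p`. Although `E₂` is only quasimodular, its anomaly is cancelled in each
root, and `S` and `T` permute the roots (`isPermutedFamily_E2`). A symmetric expression in such a
family is a form of level one, and there is no nonzero cusp form of weight less than `12`
(`eq_zero_of_tendsto_zero`); hence a linear relation between symmetric sums holds as soon as it
holds between the limits at `i∞` (`IsPermutedFamily.sum_eq_zero`). This yields the power sums of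
the roots, whence the polynomial equation. With `g` the difference of the two sides of the
`E₄`-relation, it also yields `∑ gᵢ eᵢ ^ m = 0` for `m ≤ p`, and since the root `e` is simple
(a multiple root would force `E₄³ = E₆²`, that is `Δ = 0`), `g = 0` follows as for a Vandermonde
system.

At `pτ` the dual isogeny has root `-e / p` (`isogenyRoot_some_zero_scale`), so the polynomial
equation there gives `E₆(pτ)`. At each `τ` one more relation is known (`E₄(τ) = 0`, `E₆(τ) = 0`, or
`E₄(pτ)` as a multiple of `E₄(τ)`), so that `E₄(pτ) = a e²` and `E₆(pτ) = b e³` with explicit `a`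
and `b`, and `j(pτ) = 1728 a³ / (a³ - b²)`. For `E₆(τ) = 0` and `p = 3` there are two candidates
for `E₄(τ) / e²`, of opposite signs; they are told apart by the sign of `E₄(τ)`, because `e` is
real.
-/

section Auxiliary

open scoped ArithmeticFunction.sigma
open Filter Topology ModularForm EisensteinSeries ModularGroup Manifold MatrixGroups

namespace ModularJ

/-! ### Vanishing of level-one forms of small weight -/

theorem denom_T (τ : ℍ) : denom T τ = 1 := by
  simp [ModularGroup.denom_apply, coe_T]

/-- A function with the transformation behaviour of a level-one form of weight `k < 12` which tends
to `0` at `i∞` is a cusp form, hence zero. -/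
theorem eq_zero_of_tendsto_zero {k : ℕ} (hk : k < 12) {f : ℍ → ℂ} (hf : MDiff f)
    (hS : ∀ τ, f (S • τ) = (τ : ℂ) ^ k * f τ) (hT : ∀ τ, f (T • τ) = f τ)
    (hlim : Tendsto f atImInfty (𝓝 0)) (τ : ℍ) : f τ = 0 := by
  have hS' : f ∣[(k : ℤ)] S = f := by
    ext z
    rw [SL_slash_apply, hS, denom_S, zpow_neg, zpow_natCast, mul_comm, ← mul_assoc,
      inv_mul_cancel₀ (pow_ne_zero _ z.ne_zero), one_mul]
  have hT' : f ∣[(k : ℤ)] T = f := by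
    ext z
    rw [SL_slash_apply, hT, denom_T]
    simp
  have hinv := SlashInvariantForm.slash_action_generators_SL2Z hS' hT'
  let F : CuspForm 𝒮ℒ k :=
    { toFun := f
      slash_action_eq' := by
        rintro _ ⟨γ, rfl⟩
        exact hinv γ
      holo' := hf
      zero_at_cusps' := fun hc ↦ by
        rw [Subgroup.IsArithmetic.isCusp_iff_isCusp_SL2Z] at hc
        rw [OnePoint.isZeroAt_iff_forall_SL2Z hc]
        intro γ _
        rw [hinv γ]
        exact hlim }
  have hF : F = 0 := rank_zero_iff_forall_zero.mp
    (CuspForm.rank_eq_zero_of_weight_lt_twelve (by exact_mod_cast hk)) F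
  exact congrArg (fun G : CuspForm 𝒮ℒ k ↦ G τ) hF

/-! ### Families permuted by the modular group -/

/-- A finite family `u` of holomorphic functions on `ℍ` with limits `c` at `i∞`, on which the weight
`k` actions of `S` and `T` are given by the permutations `σ₁` and `σ₂` of the index set. -/
structure IsPermutedFamily {ι : Type} (σ₁ σ₂ : Equiv.Perm ι) (k : ℕ) (c : ι → ℂ)
    (u : ι → ℍ → ℂ) : Prop where
  mdiff : ∀ i, MDiff (u i)
  map_S : ∀ i τ, u i (S • τ) = (τ : ℂ) ^ k * u (σ₁ i) τ
  map_T : ∀ i τ, u i (T • τ) = u (σ₂ i) τ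
  lim : ∀ i, Tendsto (u i) atImInfty (𝓝 (c i))

namespace IsPermutedFamily

variable {ι : Type} {σ₁ σ₂ : Equiv.Perm ι} {k l : ℕ} {c d : ι → ℂ} {u v : ι → ℍ → ℂ}

theorem mul (hu : IsPermutedFamily σ₁ σ₂ k c u) (hv : IsPermutedFamily σ₁ σ₂ l d v) :
    IsPermutedFamily σ₁ σ₂ (k + l) (fun i ↦ c i * d i) (fun i τ ↦ u i τ * v i τ) where
  mdiff i := (hu.mdiff i).mul (hv.mdiff i)
  map_S i τ := by rw [hu.map_S, hv.map_S]; ring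
  map_T i τ := by rw [hu.map_T, hv.map_T]
  lim i := (hu.lim i).mul (hv.lim i)

theorem sub (hu : IsPermutedFamily σ₁ σ₂ k c u) (hv : IsPermutedFamily σ₁ σ₂ k d v) :
    IsPermutedFamily σ₁ σ₂ k (fun i ↦ c i - d i) (fun i τ ↦ u i τ - v i τ) where
  mdiff i := (hu.mdiff i).sub (hv.mdiff i)
  map_S i τ := by rw [hu.map_S, hv.map_S]; ring
  map_T i τ := by rw [hu.map_T, hv.map_T]
  lim i := (hu.lim i).sub (hv.lim i)

theorem const_mul (a : ℂ) (hu : IsPermutedFamily σ₁ σ₂ k c u) :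
    IsPermutedFamily σ₁ σ₂ k (fun i ↦ a * c i) (fun i τ ↦ a * u i τ) where
  mdiff i := mdifferentiable_const.mul (hu.mdiff i)
  map_S i τ := by rw [hu.map_S]; ring
  map_T i τ := by rw [hu.map_T]
  lim i := (hu.lim i).const_mul a

theorem pow (hu : IsPermutedFamily σ₁ σ₂ k c u) (n : ℕ) :
    IsPermutedFamily σ₁ σ₂ (k * n) (fun i ↦ c i ^ n) (fun i τ ↦ u i τ ^ n) where
  mdiff i := (hu.mdiff i).pow n
  map_S i τ := by rw [hu.map_S, mul_pow, pow_mul]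
  map_T i τ := by rw [hu.map_T]
  lim i := (hu.lim i).pow n

/-- The sum of a permuted family of weight less than `12` vanishes as soon as its limit at `i∞`
vanishes. -/
theorem sum_eq_zero [Fintype ι] (hu : IsPermutedFamily σ₁ σ₂ k c u) (hk : k < 12)
    (hc : ∑ i, c i = 0) (τ : ℍ) : ∑ i, u i τ = 0 := by
  refine eq_zero_of_tendsto_zero (f := fun τ ↦ ∑ i, u i τ) hk ?_ ?_ ?_ ?_ τ
  · have h : MDiff (∑ i, u i) := MDifferentiable.sum (fun i _ ↦ hu.mdiff i)
    simpa [Finset.sum_fn] using h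
  · intro τ
    simp only [hu.map_S, ← Finset.mul_sum]
    rw [Equiv.sum_comp σ₁ (fun i ↦ u i τ)]
  · intro τ
    simp only [hu.map_T]
    exact Equiv.sum_comp σ₂ (fun i ↦ u i τ)
  · rw [← hc]
    exact tendsto_finsetSum _ fun i _ ↦ hu.lim i

end IsPermutedFamily

/-! ### Eisenstein series: transformation laws and limits -/

section LevelOne

/-- The transformation law of `E₂`, with its quasimodular anomaly. -/
theorem E2_smul (γ : SL(2, ℤ)) (τ : ℍ) :
    E2 (γ • τ) = denom γ τ ^ 2 * E2 τ + 6 / (Real.pi * I) * γ 1 0 * denom γ τ := by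
  have h := congrFun (E2_slash_action γ) τ
  have hd := denom_ne_zero γ τ
  have hpi : (Real.pi : ℂ) ≠ 0 := by exact_mod_cast Real.pi_ne_zero
  rw [SL_slash_apply] at h
  simp only [Pi.sub_apply, Pi.smul_apply, smul_eq_mul, D2, riemannZeta_two, zpow_neg] at h
  have h2 : E2 (γ • τ) = denom γ τ ^ 2 * (E2 τ - 1 / (2 * (↑Real.pi ^ 2 / 6)) *
      (2 * ↑Real.pi * I * (γ 1 0) / denom γ τ)) := by
    rw [← h]
    field_simp
  rw [h2]
  field_simp
  linear_combination (- 6 * (γ 1 0 : ℂ)) * I_sq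

/-- A function given by a `q`-expansion without negative exponents tends to its constant term. -/
theorem tendsto_of_hasSum_qExpansion {f : ℍ → ℂ} {c : ℕ → ℂ}
    (h : ∀ τ : ℍ, HasSum (fun m ↦ c m • Function.Periodic.qParam 1 τ ^ m) (f τ)) :
    Tendsto f atImInfty (𝓝 (c 0)) := by
  -- `(f - c 0) / q` has a `q`-expansion as well, so it is bounded and `f - c 0 = O(q)`.
  have hg (τ : ℍ) : HasSum (fun m ↦ c (m + 1) • Function.Periodic.qParam 1 τ ^ m)
      ((f τ - c 0) / Function.Periodic.qParam 1 τ) := by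
    have hq : Function.Periodic.qParam 1 τ ≠ 0 := Function.Periodic.qParam_ne_zero _
    have h1 := ((hasSum_nat_add_iff' 1).mpr (h τ)).div_const (Function.Periodic.qParam 1 τ)
    simp only [Finset.range_one, Finset.sum_singleton, pow_zero, smul_eq_mul, mul_one] at h1
    convert! h1 using 2 with m
    rw [pow_succ, smul_eq_mul]
    field_simp
  have hb := isBoundedAtImInfty_of_hasSum_qExpansion one_pos hg
  have hz := (qParam_tendsto_atImInfty one_pos).zero_mul_isBoundedUnder_le
    (Asymptotics.IsBigO.isBoundedUnder_le hb)
  have := hz.add_const (c 0)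
  rw [zero_add] at this
  refine this.congr fun τ ↦ ?_
  have hq : Function.Periodic.qParam 1 τ ≠ 0 := Function.Periodic.qParam_ne_zero _
  field_simp
  ring

theorem tendsto_E2 : Tendsto E2 atImInfty (𝓝 1) := by
  refine tendsto_of_hasSum_qExpansion (c := fun m ↦ if m = 0 then 1 else -24 * σ 1 m) fun τ ↦ ?_
  simpa only [Function.Periodic.qParam, ofReal_one, div_one] using hasSum_qExpansion_E2 (z := τ)

theorem tendsto_E {k : ℕ} (hk : 3 ≤ k) (hk2 : Even k) : Tendsto (E hk) atImInfty (𝓝 1) := by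
  rw [← E_qExpansion_coeff_zero hk hk2]
  exact tendsto_of_hasSum_qExpansion fun τ ↦
    ModularForm.hasSum_qExpansion (E hk) one_pos one_mem_strictPeriods_SL τ

end LevelOne

/-! ### Isogenous points and isogeny families -/

theorem mdifferentiable_comp_affine {f : ℍ → ℂ} (hf : MDiff f) {g : ℍ → ℍ} {a b : ℂ}
    (hg : ∀ τ, (g τ : ℂ) = a * τ + b) : MDiff (fun τ ↦ f (g τ)) := by
  have hga : MDiff g := by
    intro τ
    have h1 : MDiffAt (fun z : ℂ ↦ ofComplex (a * z + b)) (τ : ℂ) := by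
      have := mdifferentiableAt_ofComplex (z := a * τ + b) (by rw [← hg]; exact (g τ).2)
      refine this.comp (τ : ℂ) ?_
      exact DifferentiableAt.mdifferentiableAt (by fun_prop)
    have h2 := h1.comp τ (mdifferentiable_coe τ)
    convert! h2 using 1
    ext z
    simp [← hg]
  exact hf.comp hga

theorem tendsto_affine_atImInfty {g : ℍ → ℍ} {a b : ℝ} (ha : 0 < a)
    (hg : ∀ τ, (g τ : ℂ) = a * τ + b) : Tendsto g atImInfty atImInfty := by
  refine tendsto_comap_iff.mpr ?_
  have h : UpperHalfPlane.im ∘ g = fun τ : ℍ ↦ a * τ.im := by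
    ext τ
    simp [← coe_im, hg]
  rw [h]
  exact tendsto_comap.const_mul_atTop ha

section Points

variable (p : ℕ) [NeZero p]

/-- The point `p τ` of the upper half-plane. -/
noncomputable def scale (τ : ℍ) : ℍ :=
  ⟨p * τ, by simpa using mul_pos (Nat.cast_pos.mpr (NeZero.pos p)) τ.2⟩

/-- The point `(τ + n) / p` of the upper half-plane. -/
noncomputable def shiftDiv (n : ℤ) (τ : ℍ) : ℍ :=
  ⟨(τ + n) / p, by
    simpa [div_natCast_im] using div_pos τ.2 (Nat.cast_pos.mpr (NeZero.pos p))⟩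

theorem coe_scale (τ : ℍ) : (scale p τ : ℂ) = p * τ := rfl

theorem coe_shiftDiv (n : ℤ) (τ : ℍ) : (shiftDiv p n τ : ℂ) = (τ + n) / p := rfl

/-- The family `p ^ k f(pτ)`, `f((τ + a) / p)` for `a ∈ ℤ / p`, indexed by the projective line over
`ℤ / p` with `none` as the point at infinity. Up to scaling these are the values of a weight `k`
lattice function at the `p + 1` sublattices of index `p`. -/
noncomputable def isogenyFamily (k : ℕ) (f : ℍ → ℂ) : Option (ZMod p) → ℍ → ℂ
  | none, τ => p ^ k * f (scale p τ)
  | some a, τ => f (shiftDiv p a.val τ)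

/-- The limits at `i∞` of `isogenyFamily p k f` when `f` tends to `1`. -/
def isogenyLimit (k : ℕ) : Option (ZMod p) → ℂ
  | none => p ^ k
  | some _ => 1

/-- Holomorphic functions on `ℍ` with limit `1` at `i∞` which transform like a level-one form of
weight `k`, up to the anomaly `κ c (cτ + d)`. This treats `E₂` (`k = 2`) and the modular Eisenstein
series (`κ = 0`) at once. -/
structure IsQuasimodular (k : ℕ) (κ : ℂ) (f : ℍ → ℂ) : Prop where
  mdiff : MDiff f
  map_smul : ∀ (γ : SL(2, ℤ)) τ, f (γ • τ) = denom γ τ ^ k * f τ + κ * γ 1 0 * denom γ τ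
  lim : Tendsto f atImInfty (𝓝 1)

theorem isQuasimodular_E2 : IsQuasimodular 2 (6 / (Real.pi * I)) E2 :=
  ⟨E2_mdifferentiable, E2_smul, tendsto_E2⟩

theorem isQuasimodular_E {k : ℕ} (hk : 3 ≤ k) (hk2 : Even k) :
    IsQuasimodular k 0 (E hk) where
  mdiff := (E hk).holo'
  map_smul γ τ := by
    have h : ((E hk : ℍ → ℂ) ∣[(k : ℤ)] γ) τ = E hk τ :=
      congrFun (SlashInvariantForm.slash_action_eqn (E hk) _ ⟨γ, rfl⟩) τ
    rw [SL_slash_apply] at h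
    rw [← h, mul_comm, zpow_neg, zpow_natCast, mul_assoc,
      inv_mul_cancel₀ (pow_ne_zero _ (denom_ne_zero _ _))]
    simp
  lim := tendsto_E hk hk2

namespace IsQuasimodular

variable {p} {k : ℕ} {κ : ℂ} {f : ℍ → ℂ} (hf : IsQuasimodular k κ f)
include hf

theorem map_S (τ : ℍ) : f (S • τ) = (τ : ℂ) ^ k * f τ + κ * τ := by
  rw [hf.map_smul, denom_S]
  simp [coe_S]

theorem map_T (τ : ℍ) : f (T • τ) = f τ := by
  rw [hf.map_smul, denom_T]
  simp [coe_T]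

theorem map_T_zpow (n : ℤ) (τ : ℍ) : f (T ^ n • τ) = f τ := by
  rw [hf.map_smul, ModularGroup.denom_apply]
  simp [coe_T_zpow]

theorem congr_coe_add_int {τ τ' : ℍ} (n : ℤ) (h : (τ' : ℂ) = τ + n) : f τ' = f τ := by
  rw [← hf.map_T_zpow n τ]
  congr 1
  ext
  rw [h, modular_T_zpow_smul, coe_vadd]
  push_cast
  ring

end IsQuasimodular

end Points

/-! ### The action of the modular group on isogeny families -/

section Isogenies

variable (p : ℕ)

/-- The action of `T` on the projective line over `ℤ / p`: `a ↦ a + 1`, fixing infinity. -/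
def permT : Equiv.Perm (Option (ZMod p)) := (Equiv.addRight 1).optionCongr

variable [Fact p.Prime]

/-- The action of `S` on the projective line over `ℤ / p`: `a ↦ -1 / a`, exchanging `0` and
infinity. -/
def invS : Option (ZMod p) → Option (ZMod p)
  | none => some 0
  | some a => if a = 0 then none else some (-a⁻¹)

theorem involutive_invS : Function.Involutive (invS p) := by
  rintro (_ | a)
  · simp [invS]
  · by_cases ha : a = 0
    · simp [invS, ha]
    · simp [invS, ha, inv_neg]

/-- The map `invS` as a permutation. -/
def permS : Equiv.Perm (Option (ZMod p)) := (involutive_invS p).toPerm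

namespace IsQuasimodular

variable {p} {k : ℕ} {κ : ℂ} {f : ℍ → ℂ} (hf : IsQuasimodular k κ f)
include hf

theorem mdiff_isogenyFamily (i : Option (ZMod p)) : MDiff (isogenyFamily p k f i) := by
  rcases i with _ | a
  · exact mdifferentiable_const.mul (mdifferentiable_comp_affine hf.mdiff (a := p) (b := 0)
      fun τ ↦ by simp [coe_scale])
  · exact mdifferentiable_comp_affine hf.mdiff (a := 1 / p) (b := (a.val : ℤ) / p)
      fun τ ↦ by rw [coe_shiftDiv]; ring

theorem tendsto_isogenyFamily (i : Option (ZMod p)) :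
    Tendsto (isogenyFamily p k f i) atImInfty (𝓝 (isogenyLimit p k i)) := by
  have hp : (0 : ℝ) < p := Nat.cast_pos.mpr (NeZero.pos p)
  rcases i with _ | a
  · have h := hf.lim.comp (tendsto_affine_atImInfty (g := scale p) (a := p) (b := 0) hp
      fun τ ↦ by simp [coe_scale])
    simpa only [isogenyLimit, mul_one] using! h.const_mul ((p : ℂ) ^ k)
  · exact hf.lim.comp (tendsto_affine_atImInfty (g := shiftDiv p a.val) (a := 1 / p)
      (b := (a.val : ℤ) / p) (by positivity) fun τ ↦ by rw [coe_shiftDiv]; push_cast; ring)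

theorem isogenyFamily_T (i : Option (ZMod p)) (τ : ℍ) :
    isogenyFamily p k f i (T • τ) = isogenyFamily p k f (permT p i) τ := by
  have hp : (p : ℂ) ≠ 0 := NeZero.ne _
  rcases i with _ | a
  · change _ * _ = _ * _
    congr 1
    refine hf.congr_coe_add_int p ?_
    rw [coe_scale, coe_scale, modular_T_smul, coe_vadd]
    push_cast
    ring
  · change f _ = f _
    obtain ⟨m, hm⟩ : (p : ℤ) ∣ (a.val : ℤ) + 1 - ((a + 1).val : ℤ) := by
      rw [← ZMod.intCast_zmod_eq_zero_iff_dvd _ p]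
      simp
    refine hf.congr_coe_add_int m ?_
    have hm' : (a.val : ℂ) + 1 - ((a + 1).val : ℂ) = p * m := by exact_mod_cast hm
    change _ = (shiftDiv p ((a + 1).val : ℤ) τ : ℂ) + m
    rw [coe_shiftDiv, coe_shiftDiv, modular_T_smul, coe_vadd]
    field_simp
    push_cast
    linear_combination hm'

/-- The inversion `S` permutes the isogeny family up to an anomaly which is the same for all its
members. -/
theorem isogenyFamily_S (hκ : κ = 0 ∨ k = 2) (i : Option (ZMod p)) (τ : ℍ) :
    isogenyFamily p k f i (S • τ) =
      (τ : ℂ) ^ k * isogenyFamily p k f (permS p i) τ + κ * p * τ := by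
  have hp : (p : ℂ) ≠ 0 := NeZero.ne _
  have hτ := τ.ne_zero
  rcases i with _ | a
  · change _ * f _ = _ * f (shiftDiv p ((0 : ZMod p).val : ℤ) τ) + _
    have h : scale p (S • τ) = S • shiftDiv p ((0 : ZMod p).val : ℤ) τ := by
      ext
      rw [coe_scale, modular_S_smul, modular_S_smul]
      simp only [coe_shiftDiv, ZMod.val_zero]
      field_simp
      simp [hτ]
    rw [h, hf.map_S, coe_shiftDiv]
    rcases hκ with rfl | rfl <;> simp [div_pow] <;> field_simp
  · by_cases ha : a = 0
    · subst ha
      change f _ = _ * isogenyFamily p k f (if (0 : ZMod p) = 0 then none else _) τ + _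
      rw [if_pos rfl]
      change f _ = _ * (_ * f _) + _
      have h : shiftDiv p ((0 : ZMod p).val : ℤ) (S • τ) = S • scale p τ := by
        ext
        rw [coe_shiftDiv, modular_S_smul, modular_S_smul]
        simp only [coe_scale, ZMod.val_zero]
        field_simp
        simp
      rw [h, hf.map_S, coe_scale]
      ring
    · change f _ = _ * isogenyFamily p k f (if a = 0 then none else _) τ + _
      rw [if_neg ha]
      change f _ = _ * f _ + _
      set b : ZMod p := -a⁻¹ with hb
      obtain ⟨m, hm⟩ : (p : ℤ) ∣ (a.val : ℤ) * b.val + 1 := by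
        rw [← ZMod.intCast_zmod_eq_zero_iff_dvd _ p]
        simp [hb, ha]
      have hm' : (a.val : ℂ) * b.val + 1 = p * m := by exact_mod_cast hm
      -- With `ab + 1 = pm` and `w = (τ + b) / p`, the matrix `γ = (a, -m; p, -b)` satisfies
      -- `γ w = (-1 / τ + a) / p`, and its automorphy factor at `w` is `pw - b = τ`.
      let γ : SL(2, ℤ) := ⟨!![(a.val : ℤ), -m; p, -b.val], by
        rw [Matrix.det_fin_two_of]; linarith⟩
      have hden : denom γ (shiftDiv p b.val τ) = τ := by
        rw [ModularGroup.denom_apply, coe_shiftDiv]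
        simp [γ]
        field_simp
        ring
      have h : shiftDiv p a.val (S • τ) = γ • shiftDiv p b.val τ := by
        ext
        rw [coe_specialLinearGroup_apply]
        have := hden
        rw [ModularGroup.denom_apply] at this
        simp only [algebraMap_int_eq, Int.coe_castRingHom, ofReal_intCast]
        rw [this, coe_shiftDiv, coe_shiftDiv, modular_S_smul]
        simp [γ, -ZMod.natCast_val]
        field_simp
        linear_combination -hm'
      rw [h, hf.map_smul, hden]
      simp [γ]
end IsQuasimodular

/-- Subtracting `p E₂(τ)` cancels the anomaly of the isogeny family of `E₂`. -/
theorem isPermutedFamily_E2 : IsPermutedFamily (permS p) (permT p) 2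
    (fun i ↦ isogenyLimit p 2 i - p) (fun i τ ↦ isogenyFamily p 2 E2 i τ - p * E2 τ) where
  mdiff i := (isQuasimodular_E2.mdiff_isogenyFamily i).sub
    (mdifferentiable_const.mul E2_mdifferentiable)
  map_S i τ := by
    rw [isQuasimodular_E2.isogenyFamily_S (.inr rfl), isQuasimodular_E2.map_S]
    ring
  map_T i τ := by rw [isQuasimodular_E2.isogenyFamily_T, isQuasimodular_E2.map_T]
  lim i := by
    simpa using (isQuasimodular_E2.tendsto_isogenyFamily i).sub (tendsto_E2.const_mul (p : ℂ))

theorem isPermutedFamily_E {k : ℕ} (hk : 3 ≤ k) (hk2 : Even k) :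
    IsPermutedFamily (permS p) (permT p) k (isogenyLimit p k) (isogenyFamily p k (E hk)) where
  mdiff i := (isQuasimodular_E hk hk2).mdiff_isogenyFamily i
  map_S i τ := by
    rw [(isQuasimodular_E hk hk2).isogenyFamily_S (.inl rfl)]
    ring
  map_T i τ := (isQuasimodular_E hk hk2).isogenyFamily_T i τ
  lim i := (isQuasimodular_E hk hk2).tendsto_isogenyFamily i

theorem isPermutedFamily_const {k : ℕ} (hk : 3 ≤ k) (hk2 : Even k) :
    IsPermutedFamily (permS p) (permT p) k (fun _ ↦ 1) (fun _ ↦ E hk) where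
  mdiff _ := (E hk).holo'
  map_S _ τ := by rw [(isQuasimodular_E hk hk2).map_S]; ring
  map_T _ τ := (isQuasimodular_E hk hk2).map_T τ
  lim _ := tendsto_E hk hk2

end Isogenies

/-! ### Isogeny roots -/

theorem E₄_cube_ne_E₆_sq (τ : ℍ) : E₄ τ ^ 3 ≠ E₆ τ ^ 2 := by
  intro h
  apply discriminant_ne_zero τ
  rw [discriminant_eq_E₄_cube_sub_E₆_sq, h, sub_self, zero_div]

/-- The weight `2` form `p² E₂(pτ) - p E₂(τ)` (for `i = none`) and its conjugates
`E₂((τ + a) / p) - p E₂(τ)` (for `i = some a`). -/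
noncomputable def isogenyRoot (p : ℕ) (i : Option (ZMod p)) [NeZero p] (τ : ℍ) : ℂ :=
  isogenyFamily p 2 E2 i τ - p * E2 τ

theorem isogenyRoot_none (p : ℕ) [NeZero p] (τ : ℍ) :
    isogenyRoot p none τ = p ^ 2 * E2 (scale p τ) - p * E2 τ := rfl

/-- The isogeny root of the dual isogeny from `pτ` back to `τ`. -/
theorem isogenyRoot_some_zero_scale (p : ℕ) [NeZero p] (τ : ℍ) :
    isogenyRoot p (some 0) (scale p τ) = -isogenyRoot p none τ / p := by
  have hp : (p : ℂ) ≠ 0 := NeZero.ne _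
  have h : shiftDiv p ((0 : ZMod p).val : ℤ) (scale p τ) = τ := by
    ext
    rw [coe_shiftDiv, coe_scale]
    simp [hp]
  rw [isogenyRoot_none]
  change E2 (shiftDiv p ((0 : ZMod p).val : ℤ) (scale p τ)) - _ = _
  rw [h]
  field_simp
  ring

theorem sum_option_zmod_two (f : Option (ZMod 2) → ℂ) :
    ∑ i, f i = f none + f (some 0) + f (some 1) := by
  rw [Fintype.sum_option, add_assoc]
  exact congrArg (f none + ·) (Fin.sum_univ_two fun a : ZMod 2 ↦ f (some a))

theorem sum_option_zmod_three (f : Option (ZMod 3) → ℂ) :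
    ∑ i, f i = f none + f (some 0) + f (some 1) + f (some 2) := by
  rw [Fintype.sum_option, add_assoc, add_assoc, ← add_assoc (f (some 0))]
  exact congrArg (f none + ·) (Fin.sum_univ_three fun a : ZMod 3 ↦ f (some a))

/-! ### Elimination -/

section Elimination

variable {A B x y z w : ℂ}

/-- The cubic with roots `x`, `y`, `z`, and its derivative at `x`, in terms of power sums. -/
theorem cubic_of_sums (h1 : x + y + z = 0) (h2 : x ^ 2 + y ^ 2 + z ^ 2 = 6 * A)
    (h3 : x ^ 3 + y ^ 3 + z ^ 3 = 6 * B) :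
    x ^ 3 - 3 * A * x - 2 * B = 0 ∧ (x - y) * (x - z) = 3 * x ^ 2 - 3 * A := by
  obtain rfl : z = -x - y := by linear_combination h1
  constructor
  · linear_combination x / 2 * h2 + h3 / 3
  · linear_combination -h2 / 2

/-- The quartic with roots `w`, `x`, `y`, `z`, and its derivative at `w`, in terms of power sums. -/
theorem quartic_of_sums (h1 : w + x + y + z = 0)
    (h2 : w ^ 2 + x ^ 2 + y ^ 2 + z ^ 2 = 48 * A)
    (h3 : w ^ 3 + x ^ 3 + y ^ 3 + z ^ 3 = 192 * B)
    (h4 : w ^ 4 + x ^ 4 + y ^ 4 + z ^ 4 = 1344 * A ^ 2) :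
    w ^ 4 - 24 * A * w ^ 2 - 64 * B * w - 48 * A ^ 2 = 0 ∧
      (w - x) * (w - y) * (w - z) = 4 * w ^ 3 - 48 * A * w - 64 * B := by
  obtain rfl : z = -w - x - y := by linear_combination h1
  have hA : A = (w ^ 2 + x ^ 2 + y ^ 2 + (-w - x - y) ^ 2) / 48 := by linear_combination -h2 / 48
  have hB : B = (w ^ 3 + x ^ 3 + y ^ 3 + (-w - x - y) ^ 3) / 192 := by
    linear_combination -h3 / 192
  constructor
  · rw [hA] at h4 ⊢
    rw [hB]
    linear_combination h4 / 4
  · rw [hA, hB]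
    ring

/-- Three homogeneous Vandermonde equations force `a = 0` if the node `x` of `a` is simple. -/
theorem eq_zero_of_sums_three {a b c : ℂ} (h0 : a + b + c = 0) (h1 : a * x + b * y + c * z = 0)
    (h2 : a * x ^ 2 + b * y ^ 2 + c * z ^ 2 = 0) (hne : (x - y) * (x - z) ≠ 0) : a = 0 := by
  refine (mul_eq_zero.mp ?_).resolve_right hne
  linear_combination h2 - (y + z) * h1 + y * z * h0

/-- Four homogeneous Vandermonde equations force `a = 0` if the node `w` of `a` is simple. -/
theorem eq_zero_of_sums_four {a b c d : ℂ} (h0 : a + b + c + d = 0)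
    (h1 : a * w + b * x + c * y + d * z = 0)
    (h2 : a * w ^ 2 + b * x ^ 2 + c * y ^ 2 + d * z ^ 2 = 0)
    (h3 : a * w ^ 3 + b * x ^ 3 + c * y ^ 3 + d * z ^ 3 = 0)
    (hne : (w - x) * (w - y) * (w - z) ≠ 0) : a = 0 := by
  refine (mul_eq_zero.mp ?_).resolve_right hne
  linear_combination h3 - (x + y + z) * h2 + (x * y + y * z + z * x) * h1 - x * y * z * h0

end Elimination

/-! ### Relations between symmetric sums of isogeny roots -/

section PowerSums

variable (p : ℕ) [Fact p.Prime] (τ : ℍ)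

theorem sum_isogenyRoot (hc : ∑ i, (isogenyLimit p 2 i - p) = 0) :
    ∑ i, isogenyRoot p i τ = 0 :=
  (isPermutedFamily_E2 p).sum_eq_zero (by norm_num) hc τ

theorem sum_isogenyRoot_sq (c : ℂ) (hc : ∑ i, ((isogenyLimit p 2 i - p) ^ 2 - c * 1) = 0) :
    ∑ i, (isogenyRoot p i τ ^ 2 - c * E₄ τ) = 0 :=
  (((isPermutedFamily_E2 p).pow 2).sub
    ((isPermutedFamily_const p (k := 4) (by norm_num) ⟨2, rfl⟩).const_mul c)).sum_eq_zero
      (by norm_num) hc τ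

theorem sum_isogenyRoot_cube (c : ℂ) (hc : ∑ i, ((isogenyLimit p 2 i - p) ^ 3 - c * 1) = 0) :
    ∑ i, (isogenyRoot p i τ ^ 3 - c * E₆ τ) = 0 :=
  (((isPermutedFamily_E2 p).pow 3).sub
    ((isPermutedFamily_const p (k := 6) (by norm_num) ⟨3, rfl⟩).const_mul c)).sum_eq_zero
      (by norm_num) hc τ

theorem sum_isogenyRoot_pow_four (c : ℂ)
    (hc : ∑ i, ((isogenyLimit p 2 i - p) ^ 4 - c * 1 ^ 2) = 0) :
    ∑ i, (isogenyRoot p i τ ^ 4 - c * E₄ τ ^ 2) = 0 :=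
  (((isPermutedFamily_E2 p).pow 4).sub
    (((isPermutedFamily_const p (k := 4) (by norm_num) ⟨2, rfl⟩).pow 2).const_mul c)).sum_eq_zero
      (by norm_num) hc τ

/-- The defect of the relation expressing `E₄` of the isogenous lattice as `a E₄ + b e²`. -/
noncomputable def e4Defect (a b : ℂ) (i : Option (ZMod p)) (τ : ℍ) : ℂ :=
  isogenyFamily p 4 E₄ i τ - a * E₄ τ - b * isogenyRoot p i τ ^ 2

/-- The weight is `4 + 2m < 12`, and each summand vanishes at `i∞` by itself. -/
theorem sum_e4Defect_mul_pow (a b : ℂ)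
    (hc : ∀ i, isogenyLimit p 4 i - a * 1 - b * (isogenyLimit p 2 i - p) ^ 2 = 0)
    (m : ℕ) (hm : m < 4) : ∑ i, e4Defect p a b i τ * isogenyRoot p i τ ^ m = 0 :=
  ((((isPermutedFamily_E p (k := 4) (by norm_num) ⟨2, rfl⟩).sub
    ((isPermutedFamily_const p (k := 4) (by norm_num) ⟨2, rfl⟩).const_mul a)).sub
    (((isPermutedFamily_E2 p).pow 2).const_mul b)).mul
    ((isPermutedFamily_E2 p).pow m)).sum_eq_zero (by lia)
      (Finset.sum_eq_zero fun i _ ↦ by rw [hc, zero_mul]) τ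

end PowerSums

/-! ### The relations for `p = 2` -/

section LevelTwo

variable (τ : ℍ)

theorem sum_isogenyRoot_two : isogenyRoot 2 none τ + isogenyRoot 2 (some 0) τ +
    isogenyRoot 2 (some 1) τ = 0 := by
  have h := sum_isogenyRoot 2 τ (by rw [sum_option_zmod_two]; norm_num [isogenyLimit])
  rwa [sum_option_zmod_two] at h

theorem sum_isogenyRoot_two_sq : isogenyRoot 2 none τ ^ 2 + isogenyRoot 2 (some 0) τ ^ 2 +
    isogenyRoot 2 (some 1) τ ^ 2 = 6 * E₄ τ := by
  have h := sum_isogenyRoot_sq 2 τ 2 (by rw [sum_option_zmod_two]; norm_num [isogenyLimit])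
  rw [sum_option_zmod_two] at h
  linear_combination h

theorem sum_isogenyRoot_two_cube : isogenyRoot 2 none τ ^ 3 + isogenyRoot 2 (some 0) τ ^ 3 +
    isogenyRoot 2 (some 1) τ ^ 3 = 6 * E₆ τ := by
  have h := sum_isogenyRoot_cube 2 τ 2 (by rw [sum_option_zmod_two]; norm_num [isogenyLimit])
  rw [sum_option_zmod_two] at h
  linear_combination h

theorem isogenyRoot_two_cubic (i : Option (ZMod 2)) (hi : i = none ∨ i = some 0) :
    isogenyRoot 2 i τ ^ 3 - 3 * E₄ τ * isogenyRoot 2 i τ - 2 * E₆ τ = 0 := by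
  have h1 := sum_isogenyRoot_two τ
  have h2 := sum_isogenyRoot_two_sq τ
  have h3 := sum_isogenyRoot_two_cube τ
  rcases hi with rfl | rfl
  · exact (cubic_of_sums h1 h2 h3).1
  · exact (cubic_of_sums (by linear_combination h1) (by linear_combination h2)
      (by linear_combination h3) : _ ∧ (_ - isogenyRoot 2 none τ) * (_ - isogenyRoot 2 (some 1) τ)
        = _).1

theorem isogenyRoot_two_sub_mul_sub_ne_zero :
    (isogenyRoot 2 none τ - isogenyRoot 2 (some 0) τ) *
      (isogenyRoot 2 none τ - isogenyRoot 2 (some 1) τ) ≠ 0 := by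
  obtain ⟨hP, hP'⟩ := cubic_of_sums (sum_isogenyRoot_two τ) (sum_isogenyRoot_two_sq τ)
    (sum_isogenyRoot_two_cube τ)
  rw [hP']
  intro h
  apply E₄_cube_ne_E₆_sq τ
  have h4 : E₄ τ = isogenyRoot 2 none τ ^ 2 := by linear_combination -h / 3
  have h6 : E₆ τ = -isogenyRoot 2 none τ ^ 3 := by
    rw [h4] at hP
    linear_combination -hP / 2
  rw [h4, h6]
  ring

theorem E₄_scale_two :
    16 * E₄ (scale 2 τ) = -4 * E₄ τ + 5 * isogenyRoot 2 none τ ^ 2 := by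
  have hc (i : Option (ZMod 2)) :
      isogenyLimit 2 4 i - -4 * 1 - 5 * (isogenyLimit 2 2 i - (2 : ℕ)) ^ 2 = 0 := by
    rcases i with _ | i <;> norm_num [isogenyLimit]
  have h (m : ℕ) (hm : m < 4) := sum_e4Defect_mul_pow 2 τ (-4) 5 hc m hm
  simp only [sum_option_zmod_two] at h
  have := eq_zero_of_sums_three (by simpa using h 0 (by norm_num))
    (by simpa using h 1 (by norm_num)) (h 2 (by norm_num)) (isogenyRoot_two_sub_mul_sub_ne_zero τ)
  simp only [e4Defect, isogenyFamily] at this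
  push_cast at this
  linear_combination this

end LevelTwo

/-! ### The relations for `p = 3` -/

section LevelThree

variable (τ : ℍ)

theorem sum_isogenyRoot_three : isogenyRoot 3 none τ + isogenyRoot 3 (some 0) τ +
    isogenyRoot 3 (some 1) τ + isogenyRoot 3 (some 2) τ = 0 := by
  have h := sum_isogenyRoot 3 τ (by rw [sum_option_zmod_three]; norm_num [isogenyLimit])
  rwa [sum_option_zmod_three] at h

theorem sum_isogenyRoot_three_sq : isogenyRoot 3 none τ ^ 2 + isogenyRoot 3 (some 0) τ ^ 2 +
    isogenyRoot 3 (some 1) τ ^ 2 + isogenyRoot 3 (some 2) τ ^ 2 = 48 * E₄ τ := by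
  have h := sum_isogenyRoot_sq 3 τ 12 (by rw [sum_option_zmod_three]; norm_num [isogenyLimit])
  rw [sum_option_zmod_three] at h
  linear_combination h

theorem sum_isogenyRoot_three_cube : isogenyRoot 3 none τ ^ 3 + isogenyRoot 3 (some 0) τ ^ 3 +
    isogenyRoot 3 (some 1) τ ^ 3 + isogenyRoot 3 (some 2) τ ^ 3 = 192 * E₆ τ := by
  have h := sum_isogenyRoot_cube 3 τ 48 (by rw [sum_option_zmod_three]; norm_num [isogenyLimit])
  rw [sum_option_zmod_three] at h
  linear_combination h

theorem sum_isogenyRoot_three_pow_four :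
    isogenyRoot 3 none τ ^ 4 + isogenyRoot 3 (some 0) τ ^ 4 +
      isogenyRoot 3 (some 1) τ ^ 4 + isogenyRoot 3 (some 2) τ ^ 4 = 1344 * E₄ τ ^ 2 := by
  have h := sum_isogenyRoot_pow_four 3 τ 336
    (by rw [sum_option_zmod_three]; norm_num [isogenyLimit])
  rw [sum_option_zmod_three] at h
  linear_combination h

theorem isogenyRoot_three_quartic (i : Option (ZMod 3)) (hi : i = none ∨ i = some 0) :
    isogenyRoot 3 i τ ^ 4 - 24 * E₄ τ * isogenyRoot 3 i τ ^ 2 - 64 * E₆ τ * isogenyRoot 3 i τ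
      - 48 * E₄ τ ^ 2 = 0 := by
  have h1 := sum_isogenyRoot_three τ
  have h2 := sum_isogenyRoot_three_sq τ
  have h3 := sum_isogenyRoot_three_cube τ
  have h4 := sum_isogenyRoot_three_pow_four τ
  rcases hi with rfl | rfl
  · exact (quartic_of_sums h1 h2 h3 h4).1
  · exact (quartic_of_sums (by linear_combination h1) (by linear_combination h2)
      (by linear_combination h3) (by linear_combination h4) :
        _ ∧ (_ - isogenyRoot 3 none τ) * (_ - isogenyRoot 3 (some 1) τ) *
          (_ - isogenyRoot 3 (some 2) τ) = _).1

theorem isogenyRoot_three_sub_mul_sub_ne_zero :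
    (isogenyRoot 3 none τ - isogenyRoot 3 (some 0) τ) *
      (isogenyRoot 3 none τ - isogenyRoot 3 (some 1) τ) *
      (isogenyRoot 3 none τ - isogenyRoot 3 (some 2) τ) ≠ 0 := by
  obtain ⟨hP, hP'⟩ := quartic_of_sums (sum_isogenyRoot_three τ) (sum_isogenyRoot_three_sq τ)
    (sum_isogenyRoot_three_cube τ) (sum_isogenyRoot_three_pow_four τ)
  rw [hP']
  intro h
  apply E₄_cube_ne_E₆_sq τ
  set e := isogenyRoot 3 none τ
  have h6 : E₆ τ = e ^ 3 / 16 - 3 / 4 * E₄ τ * e := by linear_combination -h / 64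
  have h4 : E₄ τ = e ^ 2 / 4 := by
    rw [h6] at hP
    have : (E₄ τ - e ^ 2 / 4) ^ 2 = 0 := by linear_combination -hP / 48
    linear_combination pow_eq_zero_iff two_ne_zero |>.mp this
  rw [h6, h4]
  ring

theorem E₄_scale_three :
    81 * E₄ (scale 3 τ) = -9 * E₄ τ + 5 / 2 * isogenyRoot 3 none τ ^ 2 := by
  have hc (i : Option (ZMod 3)) :
      isogenyLimit 3 4 i - -9 * 1 - 5 / 2 * (isogenyLimit 3 2 i - (3 : ℕ)) ^ 2 = 0 := by
    rcases i with _ | i <;> norm_num [isogenyLimit]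
  have h (m : ℕ) (hm : m < 4) := sum_e4Defect_mul_pow 3 τ (-9) (5 / 2) hc m hm
  simp only [sum_option_zmod_three] at h
  have := eq_zero_of_sums_four (by simpa using h 0 (by norm_num))
    (by simpa using h 1 (by norm_num)) (h 2 (by norm_num)) (h 3 (by norm_num))
    (isogenyRoot_three_sub_mul_sub_ne_zero τ)
  simp only [e4Defect, isogenyFamily] at this
  push_cast at this
  linear_combination this

end LevelThree

/-! ### The `j`-value at an isogenous point -/

theorem coe_S_smul (τ : ℍ) : ((S • τ : ℍ) : ℂ) = (-(τ : ℂ))⁻¹ := by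
  rw [modular_S_smul]

theorem modularJ_T_smul (τ : ℍ) : modularJ (T • τ) = modularJ τ := by
  simp only [modularJ, discriminant_eq_E₄_cube_sub_E₆_sq]
  rw [(isQuasimodular_E _ ⟨2, rfl⟩).map_T, (isQuasimodular_E _ ⟨3, rfl⟩).map_T]

theorem E₄_S_smul (τ : ℍ) : E₄ (S • τ) = (τ : ℂ) ^ 4 * E₄ τ := by
  rw [(isQuasimodular_E _ ⟨2, rfl⟩).map_S, zero_mul, add_zero]

theorem E₆_S_smul (τ : ℍ) : E₆ (S • τ) = (τ : ℂ) ^ 6 * E₆ τ := by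
  rw [(isQuasimodular_E _ ⟨3, rfl⟩).map_S, zero_mul, add_zero]

/-- The `j`-value as a function of `E₄ / e²` and `E₆ / e³`. -/
theorem modularJ_eq_of_eq_mul_pow {τ : ℍ} {e a b j : ℂ} (h4 : E₄ τ = a * e ^ 2)
    (h6 : E₆ τ = b * e ^ 3) (h : 1728 * a ^ 3 = j * (a ^ 3 - b ^ 2)) : modularJ τ = j := by
  have hne := sub_ne_zero.mpr (E₄_cube_ne_E₆_sq τ)
  rw [modularJ, discriminant_eq_E₄_cube_sub_E₆_sq, div_div_eq_mul_div, div_eq_iff hne, h4, h6]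
  linear_combination e ^ 6 * h

/-- The cubic at `2τ`, at the root `-e / 2` of the dual isogeny. -/
theorem E₆_scale_two (τ : ℍ) : 2 * E₆ (scale 2 τ) =
    -isogenyRoot 2 none τ ^ 3 / 8 + 3 / 2 * E₄ (scale 2 τ) * isogenyRoot 2 none τ := by
  have h := isogenyRoot_two_cubic (scale 2 τ) (some 0) (.inr rfl)
  rw [isogenyRoot_some_zero_scale] at h
  push_cast at h
  linear_combination -h

/-- The quartic at `3τ`, at the root `-e / 3` of the dual isogeny. Since `e` may vanish, `E₆` is only
determined up to the factor `e`. -/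
theorem E₆_scale_three_mul (τ : ℍ) : 64 / 3 * E₆ (scale 3 τ) * isogenyRoot 3 none τ =
    -isogenyRoot 3 none τ ^ 4 / 81 + 24 / 9 * E₄ (scale 3 τ) * isogenyRoot 3 none τ ^ 2 +
      48 * E₄ (scale 3 τ) ^ 2 := by
  have h := isogenyRoot_three_quartic (scale 3 τ) (some 0) (.inr rfl)
  rw [isogenyRoot_some_zero_scale] at h
  push_cast at h
  linear_combination h

/-! ### Reality and positivity -/

section Reality

theorem exists_ofReal_eq_E2 {τ : ℍ} {x : ℝ} (hx : cexp (2 * Real.pi * I * τ) = x) :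
    ∃ r : ℝ, E2 τ = r := by
  refine ⟨1 - 24 * ∑' n : ℕ+, σ 1 n * x ^ (n : ℕ), ?_⟩
  rw [E2_eq_tsum_cexp, hx]
  push_cast
  rfl

theorem exists_pos_ofReal_eq_E₄ {τ : ℍ} {x : ℝ} (hx : cexp (2 * Real.pi * I * τ) = x)
    (hx0 : 0 ≤ x) : ∃ r : ℝ, 0 < r ∧ E₄ τ = r := by
  refine ⟨1 + 240 * ∑' n : ℕ+, σ 3 n * x ^ (n : ℕ), ?_, ?_⟩
  · have : 0 ≤ ∑' n : ℕ+, (σ 3 n : ℝ) * x ^ (n : ℕ) := tsum_nonneg fun n ↦ by positivity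
    linarith
  · rw [q_expansion_bernoulli _ ⟨2, rfl⟩, hx, show bernoulli 4 = -1 / 30 by decide +kernel]
    push_cast
    simp only [zpow_natCast]
    norm_num

theorem cexp_of_re_eq_zero {τ : ℍ} {t : ℝ} (hτ : (τ : ℂ) = t * I) :
    cexp (2 * Real.pi * I * τ) = (Real.exp (-2 * Real.pi * t) : ℝ) := by
  rw [hτ]
  push_cast
  congr 1
  linear_combination (2 * Real.pi * t : ℂ) * I_sq

theorem cexp_of_re_eq_half {τ : ℍ} {n : ℕ} {t : ℝ} (hτ : (τ : ℂ) = n / 2 + t * I) :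
    cexp (2 * Real.pi * I * τ) = ((-1) ^ n * Real.exp (-2 * Real.pi * t) : ℝ) := by
  have h : (2 * Real.pi * I * τ : ℂ) = n * (Real.pi * I) + (-2 * Real.pi * t : ℝ) := by
    rw [hτ]
    push_cast
    linear_combination (2 * Real.pi * t : ℂ) * I_sq
  rw [h, exp_add, exp_nat_mul, exp_pi_mul_I]
  push_cast
  rfl

end Reality

/-! ### The special values -/

section SpecialValues

/-- If the root at infinity is `S`-invariant at `τ` and vanishes there, then so does the root at `0`,
which is its image under `S`. -/
theorem isogenyRoot_some_zero_eq_zero (p : ℕ) [Fact p.Prime] {τ : ℍ}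
    (hτ : isogenyRoot p none (S • τ) = isogenyRoot p none τ) (h0 : isogenyRoot p none τ = 0) :
    isogenyRoot p (some 0) τ = 0 := by
  have h := (isPermutedFamily_E2 p).map_S none τ
  change isogenyRoot p none (S • τ) = _ * isogenyRoot p (some 0) τ at h
  rw [hτ, h0, eq_comm, mul_eq_zero] at h
  exact h.resolve_left (pow_ne_zero _ τ.ne_zero)

theorem isogenyRoot_two_ne_zero {τ : ℍ}
    (hτ : isogenyRoot 2 none (S • τ) = isogenyRoot 2 none τ) : isogenyRoot 2 none τ ≠ 0 := by
  intro h0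
  apply isogenyRoot_two_sub_mul_sub_ne_zero τ
  rw [isogenyRoot_some_zero_eq_zero 2 hτ h0, h0, sub_self, zero_mul]

theorem isogenyRoot_three_ne_zero {τ : ℍ}
    (hτ : isogenyRoot 3 none (S • τ) = isogenyRoot 3 none τ) : isogenyRoot 3 none τ ≠ 0 := by
  intro h0
  apply isogenyRoot_three_sub_mul_sub_ne_zero τ
  rw [isogenyRoot_some_zero_eq_zero 3 hτ h0, h0, sub_self, zero_mul, zero_mul]

theorem modularJ_sqrt_two_mul_I : modularJ ⟨(√2 : ℝ) * I, by simp⟩ = 20 ^ 3 := by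
  have hs : ((√2 : ℝ) : ℂ) ^ 2 = 2 := by
    rw [← ofReal_pow, Real.sq_sqrt (by norm_num)]
    norm_num
  let τ : ℍ := ⟨(√2 : ℝ) / 2 * I, by simp⟩
  have hτ : (τ : ℂ) = (√2 : ℝ) / 2 * I := rfl
  have h1 : (⟨(√2 : ℝ) * I, by simp⟩ : ℍ) = scale 2 τ := by
    ext
    rw [coe_scale, hτ, UpperHalfPlane.coe_mk]
    push_cast
    ring
  have h2 : scale 2 τ = S • τ := by
    ext
    rw [coe_scale, coe_S_smul, eq_comm, inv_eq_iff_eq_inv, eq_comm]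
    refine inv_eq_of_mul_eq_one_right ?_
    rw [hτ]
    push_cast
    linear_combination -(I ^ 2 / 2) * hs - I_sq
  have h4 := E₄_S_smul τ
  rw [← h2, hτ] at h4
  have h4' : E₄ (scale 2 τ) = E₄ τ / 4 := by
    rw [h4]
    linear_combination (E₄ τ / 16) * (I ^ 4 * ((√2 : ℝ) ^ 2 + 2) * hs + 4 * I_pow_four)
  have hE4 := E₄_scale_two τ
  have hE6 := E₆_scale_two τ
  rw [h1]
  have h4'' : E₄ (scale 2 τ) = 5 / 32 * isogenyRoot 2 none τ ^ 2 := by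
    linear_combination hE4 / 32 + h4' / 2
  refine modularJ_eq_of_eq_mul_pow (a := 5 / 32) (b := 7 / 128) h4'' ?_ (by norm_num)
  rw [h4''] at hE6
  linear_combination hE6 / 2

theorem S_smul_I : S • UpperHalfPlane.I = UpperHalfPlane.I := by
  ext
  rw [modular_S_smul]
  simp

theorem E₆_I : E₆ UpperHalfPlane.I = 0 := by
  have h := E₆_S_smul UpperHalfPlane.I
  rw [S_smul_I, UpperHalfPlane.coe_I, show I ^ 6 = -1 by rw [show 6 = 4 + 2 from rfl, pow_add]; simp]
    at h
  linear_combination h / 2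

theorem modularJ_two_mul_I : modularJ ⟨2 * I, by simp⟩ = 66 ^ 3 := by
  have h1 : (⟨2 * I, by simp⟩ : ℍ) = scale 2 UpperHalfPlane.I := by
    ext
    rw [coe_scale]
    simp
  have he : isogenyRoot 2 none UpperHalfPlane.I ≠ 0 := isogenyRoot_two_ne_zero (by rw [S_smul_I])
  have hc := isogenyRoot_two_cubic UpperHalfPlane.I none (.inl rfl)
  have hE4 := E₄_scale_two UpperHalfPlane.I
  have hE6 := E₆_scale_two UpperHalfPlane.I
  rw [E₆_I] at hc
  have h4 : E₄ UpperHalfPlane.I = isogenyRoot 2 none UpperHalfPlane.I ^ 2 / 3 := by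
    apply mul_left_cancel₀ he
    linear_combination -hc / 3
  have h4' : E₄ (scale 2 UpperHalfPlane.I) = 11 / 48 * isogenyRoot 2 none UpperHalfPlane.I ^ 2 := by
    linear_combination hE4 / 16 - h4 / 4
  rw [h1]
  refine modularJ_eq_of_eq_mul_pow (a := 11 / 48) (b := 7 / 64) h4' ?_ (by norm_num)
  rw [h4'] at hE6
  linear_combination hE6 / 2

theorem modularJ_sqrt_three_mul_I : modularJ ⟨(√3 : ℝ) * I, by simp⟩ = 16 * 15 ^ 3 := by
  have hs : ((√3 : ℝ) : ℂ) ^ 2 = 3 := by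
    rw [← ofReal_pow, Real.sq_sqrt (by norm_num)]
    norm_num
  let τ : ℍ := ⟨(√3 : ℝ) / 3 * I, by simp⟩
  have hτ : (τ : ℂ) = (√3 : ℝ) / 3 * I := rfl
  have h1 : (⟨(√3 : ℝ) * I, by simp⟩ : ℍ) = scale 3 τ := by
    ext
    rw [coe_scale, hτ, UpperHalfPlane.coe_mk]
    push_cast
    ring
  have h2 : scale 3 τ = S • τ := by
    ext
    rw [coe_scale, coe_S_smul, eq_comm, inv_eq_iff_eq_inv, eq_comm]
    refine inv_eq_of_mul_eq_one_right ?_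
    rw [hτ]
    push_cast
    linear_combination -(I ^ 2 / 3) * hs - I_sq
  have h4 := E₄_S_smul τ
  rw [← h2, hτ] at h4
  have h4' : E₄ (scale 3 τ) = E₄ τ / 9 := by
    rw [h4]
    linear_combination (E₄ τ / 81) * (I ^ 4 * ((√3 : ℝ) ^ 2 + 3) * hs + 9 * I_pow_four)
  have hE4 := E₄_scale_three τ
  have hE6 := E₆_scale_three_mul τ
  have h4'' : E₄ (scale 3 τ) = 5 / 324 * isogenyRoot 3 none τ ^ 2 := by
    linear_combination hE4 / 162 + h4' / 2
  -- The equations alone allow `e = E₄(τ) = 0`, which is the `√-3`-endomorphism of the hexagonal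
  -- lattice; positivity of `E₄` on the imaginary axis excludes it.
  have he : isogenyRoot 3 none τ ≠ 0 := by
    intro he
    obtain ⟨r, hr, hE⟩ := exists_pos_ofReal_eq_E₄ (τ := τ)
      (cexp_of_re_eq_zero (t := √3 / 3) (by rw [hτ]; push_cast; rfl)) (Real.exp_pos _).le
    have : E₄ τ = 0 := by
      rw [he] at h4''
      linear_combination 9 * h4'' - 9 * h4'
    rw [hE] at this
    exact hr.ne' (by exact_mod_cast this)
  rw [h1]
  refine modularJ_eq_of_eq_mul_pow (a := 5 / 324) (b := 11 / 5832) h4'' ?_ (by norm_num)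
  rw [h4''] at hE6
  apply mul_left_cancel₀ he
  linear_combination 3 / 64 * hE6

theorem modularJ_half_add_three_sqrt_three :
    modularJ ⟨(1 + 3 * (√3 : ℝ) * I) / 2, by simp⟩ = -3 * 160 ^ 3 := by
  have hs : ((√3 : ℝ) : ℂ) ^ 2 = 3 := by
    rw [← ofReal_pow, Real.sq_sqrt (by norm_num)]
    norm_num
  let τ : ℍ := ⟨(1 + (√3 : ℝ) * I) / 2, by simp⟩
  have hτ : (τ : ℂ) = (1 + (√3 : ℝ) * I) / 2 := rfl
  have hτ2 : (τ : ℂ) ^ 2 = τ - 1 := by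
    rw [hτ]
    linear_combination I ^ 2 / 4 * hs + 3 / 4 * I_sq
  have h1 : T • (⟨(1 + 3 * (√3 : ℝ) * I) / 2, by simp⟩ : ℍ) = scale 3 τ := by
    ext
    rw [coe_scale, hτ, modular_T_smul, coe_vadd, UpperHalfPlane.coe_mk]
    push_cast
    ring
  have h2 : τ = T • S • τ := by
    ext
    rw [modular_T_smul, coe_vadd, coe_S_smul]
    have := τ.ne_zero
    field_simp
    push_cast
    linear_combination hτ2
  have hE : E₄ τ = 0 := by
    have h := E₄_S_smul τ
    rw [← (isQuasimodular_E _ ⟨2, rfl⟩).map_T (S • τ), ← h2] at h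
    have h4 : (τ : ℂ) ^ 4 = -τ := by linear_combination (τ ^ 2 + τ : ℂ) * hτ2
    have hne : (1 + τ : ℂ) ≠ 0 := by
      intro h0
      have := congrArg Complex.re h0
      rw [hτ] at this
      norm_num at this
    rw [h4] at h
    apply mul_left_cancel₀ hne
    linear_combination h
  have he : isogenyRoot 3 none τ ≠ 0 := isogenyRoot_three_ne_zero (by
    conv_rhs => rw [h2]
    exact ((isPermutedFamily_E2 3).map_T none (S • τ)).symm)
  have hE4 := E₄_scale_three τ
  have hE6 := E₆_scale_three_mul τ
  have h4' : E₄ (scale 3 τ) = 5 / 162 * isogenyRoot 3 none τ ^ 2 := by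
    linear_combination hE4 / 81 - hE / 9
  rw [← modularJ_T_smul, h1]
  refine modularJ_eq_of_eq_mul_pow (a := 5 / 162) (b := 253 / 46656) h4' ?_ (by norm_num)
  rw [h4'] at hE6
  apply mul_left_cancel₀ he
  linear_combination 3 / 64 * hE6

/-- The value at `3τ` for `τ` equivalent to `i`; the parameter `s` is one of the square roots of
`3`. -/
theorem modularJ_scale_three_of_E₆_eq_zero {τ : ℍ} {s : ℂ} (hs : s ^ 2 = 3) (h6 : E₆ τ = 0)
    (h4 : E₄ τ = (-3 + 2 * s) / 12 * isogenyRoot 3 none τ ^ 2) :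
    modularJ (scale 3 τ) = (18 + 6 * s) * (82 + 54 * s) ^ 3 := by
  have he : isogenyRoot 3 none τ ≠ 0 := by
    intro h0
    apply E₄_cube_ne_E₆_sq τ
    rw [h6, h4, h0]
    ring
  have hE4 := E₄_scale_three τ
  have hE6 := E₆_scale_three_mul τ
  have h4' : E₄ (scale 3 τ) = (19 - 6 * s) / 324 * isogenyRoot 3 none τ ^ 2 := by
    linear_combination hE4 / 81 - h4 / 9
  refine modularJ_eq_of_eq_mul_pow (a := (19 - 6 * s) / 324) (b := (49 - 21 * s) / 2916) h4' ?_ ?_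
  · rw [h4'] at hE6
    apply mul_left_cancel₀ he
    linear_combination 3 / 64 * hE6 + (isogenyRoot 3 none τ) ^ 4 * 9 / 4 * (36 / 104976) * hs
  · have h3 : s ^ 3 = 3 * s := by linear_combination s * hs
    have h4 : s ^ 4 = 9 := by linear_combination (s ^ 2 + 3) * hs
    have h5 : s ^ 5 = 9 * s := by linear_combination s * h4
    have h6 : s ^ 6 = 27 := by linear_combination s ^ 2 * h4 + 9 * hs
    have h7 : s ^ 7 = 27 * s := by linear_combination s * h6
    ring_nf
    rw [hs, h3, h4, h5, h6, h7]
    ring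

/-- For `E₆ = 0` the quartic is a quadratic in `E₄ / e²`, with roots `(-3 ± 2 √3) / 12`. -/
theorem quadratic_of_E₆_eq_zero {τ : ℍ} {r ρ : ℝ} (h6 : E₆ τ = 0) (h4 : E₄ τ = r)
    (he : isogenyRoot 3 none τ = ρ) :
    (12 * r + 3 * ρ ^ 2 - 2 * √3 * ρ ^ 2) * (12 * r + 3 * ρ ^ 2 + 2 * √3 * ρ ^ 2) = 0 := by
  have h := isogenyRoot_three_quartic τ none (.inl rfl)
  rw [h6, h4, he] at h
  have h' : ρ ^ 4 - 24 * r * ρ ^ 2 - 48 * r ^ 2 = 0 := by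
    have : ((ρ ^ 4 - 24 * r * ρ ^ 2 - 48 * r ^ 2 : ℝ) : ℂ) = 0 := by
      push_cast
      linear_combination h
    exact_mod_cast this
  have hs : √3 ^ 2 = 3 := Real.sq_sqrt (by norm_num)
  linear_combination -3 * h' - 4 * ρ ^ 4 * hs

theorem exists_ofReal_eq_isogenyRoot (p : ℕ) [NeZero p] {τ : ℍ} {x y : ℝ}
    (hx : cexp (2 * Real.pi * I * τ) = x) (hy : cexp (2 * Real.pi * I * scale p τ) = y) :
    ∃ ρ : ℝ, isogenyRoot p none τ = ρ := by
  obtain ⟨a, ha⟩ := exists_ofReal_eq_E2 hx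
  obtain ⟨b, hb⟩ := exists_ofReal_eq_E2 hy
  refine ⟨p ^ 2 * b - p * a, ?_⟩
  rw [isogenyRoot_none, ha, hb]
  push_cast
  rfl

theorem exists_pos_ofReal_eq_E₄_I : ∃ r : ℝ, 0 < r ∧ E₄ UpperHalfPlane.I = r :=
  exists_pos_ofReal_eq_E₄ (cexp_of_re_eq_zero (t := 1) (by simp)) (Real.exp_pos _).le

theorem modularJ_three_mul_I :
    modularJ ⟨3 * I, by simp⟩ = (18 + 6 * (√3 : ℝ)) * (82 + 54 * (√3 : ℝ)) ^ 3 := by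
  have hs : ((√3 : ℝ) : ℂ) ^ 2 = 3 := by
    rw [← ofReal_pow, Real.sq_sqrt (by norm_num)]
    norm_num
  have h1 : (⟨3 * I, by simp⟩ : ℍ) = scale 3 UpperHalfPlane.I := by
    ext
    rw [coe_scale]
    simp
  obtain ⟨r, hr, h4⟩ := exists_pos_ofReal_eq_E₄_I
  obtain ⟨ρ, hρ⟩ := exists_ofReal_eq_isogenyRoot 3 (τ := UpperHalfPlane.I)
    (cexp_of_re_eq_zero (t := 1) (by simp)) (cexp_of_re_eq_zero (t := 3) (by simp [coe_scale]))
  rw [h1]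
  refine modularJ_scale_three_of_E₆_eq_zero hs E₆_I ?_
  rcases mul_eq_zero.mp (quadratic_of_E₆_eq_zero E₆_I h4 hρ) with h | h
  · have h' : r = (-3 + 2 * √3) / 12 * ρ ^ 2 := by linear_combination h / 12
    rw [h4, hρ, h']
    push_cast
    rfl
  · -- The other root is negative, while `E₄(i) > 0`.
    have : 0 ≤ √3 * ρ ^ 2 := by positivity
    nlinarith [sq_nonneg ρ]

theorem modularJ_half_add_three_mul_I :
    modularJ ⟨(1 + 3 * I) / 2, by simp⟩ =
      (18 - 6 * (√3 : ℝ)) * (82 - 54 * (√3 : ℝ)) ^ 3 := by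
  have hs : (-((√3 : ℝ) : ℂ)) ^ 2 = 3 := by
    rw [neg_sq, ← ofReal_pow, Real.sq_sqrt (by norm_num)]
    norm_num
  let τ : ℍ := ⟨(1 + I) / 2, by simp⟩
  have hτ : (τ : ℂ) = (1 + I) / 2 := rfl
  have h1 : T • (⟨(1 + 3 * I) / 2, by simp⟩ : ℍ) = scale 3 τ := by
    ext
    rw [coe_scale, hτ, modular_T_smul, coe_vadd, UpperHalfPlane.coe_mk]
    push_cast
    ring
  have h2 : UpperHalfPlane.I = T • S • τ := by
    ext
    rw [modular_T_smul, coe_vadd, coe_S_smul, UpperHalfPlane.coe_I]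
    have h0 := τ.ne_zero
    field_simp
    rw [hτ]
    push_cast
    linear_combination I_sq / 2
  have hE4 : E₄ τ = -4 * E₄ UpperHalfPlane.I := by
    have h := E₄_S_smul τ
    rw [← (isQuasimodular_E _ ⟨2, rfl⟩).map_T (S • τ), ← h2, hτ] at h
    rw [h]
    linear_combination (E₄ τ / 4) * ((I ^ 2 + 4 * I + 5) * I_sq)
  have hE6 : E₆ τ = 0 := by
    have h := E₆_S_smul τ
    rw [← (isQuasimodular_E _ ⟨3, rfl⟩).map_T (S • τ), ← h2, E₆_I, eq_comm, mul_eq_zero] at h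
    exact h.resolve_left (pow_ne_zero _ τ.ne_zero)
  obtain ⟨r, hr, h4⟩ := exists_pos_ofReal_eq_E₄_I
  have h4' : E₄ τ = (-4 * r : ℝ) := by
    rw [hE4, h4]
    push_cast
    rfl
  obtain ⟨ρ, hρ⟩ := exists_ofReal_eq_isogenyRoot 3 (τ := τ)
    (cexp_of_re_eq_half (n := 1) (t := 1 / 2) (by rw [hτ]; push_cast; ring))
    (cexp_of_re_eq_half (n := 3) (t := 3 / 2) (by rw [coe_scale, hτ]; push_cast; ring))
  rw [← modularJ_T_smul, h1]
  refine (modularJ_scale_three_of_E₆_eq_zero hs hE6 ?_).trans (by ring)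
  rcases mul_eq_zero.mp (quadratic_of_E₆_eq_zero hE6 h4' hρ) with h | h
  · -- This root is nonnegative, while `E₄(τ) = -4 E₄(i) < 0`.
    have h3 : 3 / 2 ≤ √3 := Real.le_sqrt_of_sq_le (by norm_num)
    nlinarith [mul_nonneg (sub_nonneg.mpr h3) (sq_nonneg ρ)]
  · have h' : -4 * r = (-3 - 2 * √3) / 12 * ρ ^ 2 := by linear_combination h / 12
    rw [h4', hρ, h']
    push_cast
    ring

end SpecialValues

end ModularJ

end Auxiliary

theorem corollary4p2 :
    modularJ ⟨(√3 : ℝ) * I, by simp⟩ = 16 * 15 ^ 3 ∧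
    modularJ ⟨2 * I, by simp⟩ = 66 ^ 3 ∧
    modularJ ⟨(√2 : ℝ) * I, by simp⟩ = 20 ^ 3 ∧
    modularJ ⟨(1 + 3 * (√3 : ℝ) * I) / 2, by simp⟩ = -3 * 160 ^ 3 ∧
    modularJ ⟨3 * I, by simp⟩ = (18 + 6 * (√3 : ℝ)) * (82 + 54 * (√3 : ℝ)) ^ 3 ∧
    modularJ ⟨(1 + 3 * I) / 2, by simp⟩ = (18 - 6 * (√3 : ℝ)) * (82 - 54 * (√3 : ℝ)) ^ 3 :=
  ⟨ModularJ.modularJ_sqrt_three_mul_I, ModularJ.modularJ_two_mul_I,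
    ModularJ.modularJ_sqrt_two_mul_I, ModularJ.modularJ_half_add_three_sqrt_three,
    ModularJ.modularJ_three_mul_I, ModularJ.modularJ_half_add_three_mul_I⟩
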